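/- A continuum is a nonempty compact connected metrizable space. For a point $x$ of a space $X$, let $\mathrm{ord}(x,X)$ be the least cardinal $\kappa$ such that $x$ has arbitrarily small open neighbourhoods with boundary of cardinality at most $\kappa$. A continuum $G$ is a tame graph if the set of points $x$ with $\mathrm{ord}(x,G)=1$ or $\mathrm{ord}(x,G)\ge 3$ has countable closure. A free arc in $G$ is a set $\alpha\subset G$ homeomorphic to $[0,1]$ such that $\alpha^\circ:=\alpha\setminus\{\text{endpoints of }\alpha\}$ is open in $G$. A countable Markov partition for $f\colon G\to G$ is a countable family $\mathcal P$ of free arcs with pairwise disjoint interiors $i^\circ$, covering $G$ up to a countable set, such that $f$ maps each $i\in\mathcal P$ homeomorphically onto $f(i)$, and $f(i)\supset j$ whenever $i,j\in\mathcal P$ and $f(i)\cap j^\circ\ne\emptyset$. The class $\mathcal{CPM}(G)$ consists of the continuous maps $f\colon G\to G$ that admit a countably infinite Markov partition and are topologically mixing (for all nonempty open $U,V$ there is $n$ with $f^m(U)\cap V\neq\emptyset$ for all $m\ge n$). The transition matrix $M=(m_{ij})_{i,j\in\mathcal P}$ has $m_{ij}=1$ if $f(i)\supset j$ and $m_{ij}=0$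 otherwise; $\Sigma_M=\{i_0i_1\cdots\in\mathcal P^{\mathbb N_0}: m_{i_ni_{n+1}}=1\text{ for all }n\}$ carries the topology inherited from the product of discrete spaces, and $\sigma$ is the shift map on it. In a measurable dynamical system $(X,T)$, a measurable set $N\subset X$ is small if $T^{-1}(N)\subset N$ and every $T$-invariant probability measure concentrated on $N$ has (Kolmogorov--Sinai) entropy $0$. Systems $(X,T)$ and $(X',T')$ are isomorphic modulo small sets if there are small sets $N\subset X$, $N'\subset X'$ and a bimeasurable bijection $\psi\colon X\setminus N\to X'\setminus N'$ with $T'\circ\psi=\psi\circ T$ on $X\setminus N$. **Theorem.** Let $G$ be a tame graph, let $f\in\mathcal{CPM}(G)$, and let $\mathcal P$ be a countable Markov partition for $f$, with transition matrix $M$. Then, with respect to the Borel $\sigma$-algebras, $(G,f)$ and $(\Sigma_M,\sigma)$ are isomorphic modulo small sets. More precisely, for every $i_0i_1\cdots\in\Sigma_M$ the set $\bigcap_{n\ge0}\,\bigl(i_0\cap f^{-1}(i_1)\cap\cdots\cap f^{-n}(i_n)\bigr)$ consists of a single point $\psi(i_0i_1\cdots)$; the sets $Q=\bigcup_{n\ge0}f^{-n}\bigl(G\setminus\bigcup_{i\in\mathcal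 P}i^\circ\bigr)\subset G$ and $N=\psi^{-1}(Q)\subset\Sigma_M$ are countable and small; and $\psi$ restricts to a bimeasurable bijection $\Sigma_M\setminus N\to G\setminus Q$ with $f\circ\psi=\psi\circ\sigma$ on $\Sigma_M\setminus N$. -/

import Mathlib

open Set Filter Topology MeasureTheory

universe u v

namespace TameGraph

section Continua

variable {X : Type u} [TopologicalSpace X]

/-- The order `ord(x, X)` of a point `x` of a space `X`: the least cardinal `κ` such that `x` has
arbitrarily small open neighbourhoods whose boundary has at most `κ` points. -/
noncomputable def pointOrder (x : X) : Cardinal.{u} :=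
  sInf {κ | ∀ U : Set X, IsOpen U → x ∈ U →
    ∃ V : Set X, IsOpen V ∧ x ∈ V ∧ V ⊆ U ∧ Cardinal.mk (frontier V) ≤ κ}

variable (X) in
/-- The set `E(X)` of endpoints of a space. -/
def endpoints : Set X := {x | pointOrder x = 1}

variable (X) in
/-- The set `B(X)` of branchpoints of a space. -/
def branchpoints : Set X := {x | 3 ≤ pointOrder x}

variable (X) in
/-- A tame graph: a continuum (nonempty compact connected metrizable space) in which the set of
endpoints and branchpoints has a countable closure. -/
structure IsTameGraph : Prop where
  compact : CompactSpace X
  connected : ConnectedSpace X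
  metrizable : TopologicalSpace.MetrizableSpace X
  countable_closure : (closure (endpoints X ∪ branchpoints X)).Countable

/-- An arc: a homeomorphic copy of `[0, 1]`. -/
def IsArc (α : Set X) : Prop :=
  ∃ γ : unitInterval → X, IsEmbedding γ ∧ range γ = α

/-- The two endpoints `E(α)` of an arc `α`, i.e. the points at which some parametrization
starts (every arc can be parametrized starting from either end). -/
def arcEnds (α : Set X) : Set X :=
  {x | ∃ γ : unitInterval → X, IsEmbedding γ ∧ range γ = α ∧ γ 0 = x}

/-- The interior `α° = α \ E(α)` of an arc. -/
def arcInterior (α : Set X) : Set X := α \ arcEnds α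

/-- A free arc. -/
def IsFreeArc (α : Set X) : Prop := IsArc α ∧ IsOpen (arcInterior α)

/-- A tame partition: countably many free arcs with pairwise disjoint interiors, covering the
space up to a countable set. -/
structure IsTamePartition (P : Set (Set X)) : Prop where
  countable : P.Countable
  freeArc : ∀ i ∈ P, IsFreeArc i
  disjoint : ∀ i ∈ P, ∀ j ∈ P, i ≠ j → Disjoint (arcInterior i) (arcInterior j)
  cover : (⋃₀ P)ᶜ.Countable

/-- A countable Markov partition for `f`. -/
structure IsMarkovPartition (f : X → X) (P : Set (Set X)) : Prop where
  tame : IsTamePartition P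
  monotone : ∀ i ∈ P, IsEmbedding (i.domRestrict f)
  markov : ∀ i ∈ P, ∀ j ∈ P, (f '' i ∩ arcInterior j).Nonempty → j ⊆ f '' i

/-- Topological mixing. -/
def IsTopMixing (f : X → X) : Prop :=
  ∀ U V : Set X, IsOpen U → U.Nonempty → IsOpen V → V.Nonempty →
    ∃ n : ℕ, ∀ m ≥ n, (f^[m] '' U ∩ V).Nonempty

/-- The class of countably Markov and mixing maps. -/
structure IsCPM (f : X → X) : Prop where
  continuous : Continuous f
  exists_partition : ∃ P : Set (Set X), P.Infinite ∧ IsMarkovPartition f P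
  mixing : IsTopMixing f

/-- The complement of the union of the interiors of the partition arcs. -/
def partitionPoints (P : Set (Set X)) : Set X := (⋃ i ∈ P, arcInterior i)ᶜ

/-- The set `Q` of all points that some iterate of `f` sends to the set of partition points. -/
def exceptionalSet (f : X → X) (P : Set (Set X)) : Set X :=
  ⋃ n : ℕ, f^[n] ⁻¹' partitionPoints P

open Classical in
/-- The transition matrix `M` of `f` with respect to a partition. -/
noncomputable def transitionMatrix (f : X → X) (P : Set (Set X)) : Matrix P P ℕ :=
  fun i j => if (j : Set X) ⊆ f '' (i : Set X) then 1 else 0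

end Continua

section MarkovShift

variable {ι : Type v}

/-- The space `Σ_M` of all one-sided sequences whose transitions are allowed by `M`. -/
def MarkovShift (M : Matrix ι ι ℕ) : Type v :=
  {s : ℕ → ι // ∀ n, M (s n) (s (n + 1)) = 1}

/-- The topology of `Σ_M` is inherited from the product of discrete spaces. It is spelled out
because the index type may carry an unrelated topology. -/
instance (M : Matrix ι ι ℕ) : TopologicalSpace (MarkovShift M) :=
  TopologicalSpace.induced (fun s : MarkovShift M => s.1)
    (@Pi.topologicalSpace ℕ (fun _ => ι) (fun _ => ⊥))

instance (M : Matrix ι ι ℕ) : MeasurableSpace (MarkovShift M) := borel _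

instance (M : Matrix ι ι ℕ) : BorelSpace (MarkovShift M) := ⟨rfl⟩

/-- The shift map. -/
def MarkovShift.shift (M : Matrix ι ι ℕ) (s : MarkovShift M) : MarkovShift M :=
  ⟨fun n => s.1 (n + 1), fun n => s.2 (n + 1)⟩

end MarkovShift

/-- The set `[i₀ i₁ ⋯ iₙ] = i₀ ∩ f⁻¹ i₁ ∩ ⋯ ∩ f⁻ⁿ iₙ`. -/
def cylinder {X : Type u} (f : X → X) (i : ℕ → Set X) (n : ℕ) : Set X :=
  ⋂ k ≤ n, f^[k] ⁻¹' i k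

section Entropy

variable {X : Type u} [MeasurableSpace X]

/-- The Shannon entropy of the join `ξ ∨ T⁻¹ξ ∨ ⋯ ∨ T⁻⁽ⁿ⁻¹⁾ξ`, where a finite partition is given
by its labelling function `ξ`. -/
noncomputable def blockEntropy (μ : Measure X) (T : X → X) {k : ℕ} (ξ : X → Fin k) (n : ℕ) : ℝ :=
  ∑ w : Fin n → Fin k, Real.negMulLog (μ.real {x | ∀ j : Fin n, ξ (T^[(j : ℕ)] x) = w j})

/-- The Kolmogorov-Sinai entropy `h_μ(T)`: the supremum over all finite measurable partitions `ξ`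
of `lim (1/n) H_μ(ξ ∨ ⋯ ∨ T⁻⁽ⁿ⁻¹⁾ξ)`. -/
noncomputable def measureEntropy (μ : Measure X) (T : X → X) : ENNReal :=
  ⨆ (k : ℕ) (ξ : X → Fin k) (_ : Measurable ξ),
    limsup (fun n : ℕ => ENNReal.ofReal (blockEntropy μ T ξ n / n)) atTop

/-- A small set of a measurable dynamical system. -/
structure IsSmall (T : X → X) (N : Set X) : Prop where
  measurable : MeasurableSet N
  backward : T ⁻¹' N ⊆ N
  entropy : ∀ μ : Measure X, IsProbabilityMeasure μ → MeasurePreserving T μ μ → μ Nᶜ = 0 →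
    measureEntropy μ T = 0

variable {Y : Type v} [MeasurableSpace Y]

/-- The bimeasurable bijection `e : X \ N → Y \ N'` is an isomorphism modulo the small sets
`N`, `N'`. The intertwining relation `S ∘ e = e ∘ T` makes sense since `T` maps the complement of
the backward invariant set `N` into itself; below `y` stands for `T x`. -/
structure IsIsoModSmall (T : X → X) (S : Y → Y) (N : Set X) (N' : Set Y)
    (e : ↥(Nᶜ) ≃ᵐ ↥(N'ᶜ)) : Prop where
  small_source : IsSmall T N
  small_target : IsSmall S N'
  intertwine : ∀ x y : ↥(Nᶜ), (y : X) = T x → S (e x) = e y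

/-- Two measurable dynamical systems are isomorphic modulo small sets. -/
def IsomorphicModSmallSets (T : X → X) (S : Y → Y) : Prop :=
  ∃ (N : Set X) (N' : Set Y) (e : ↥(Nᶜ) ≃ᵐ ↥(N'ᶜ)), IsIsoModSmall T S N N' e

end Entropy

end TameGraph

/-!
For an itinerary `s`, the cylinders `[s₀ ⋯ sₙ]` are decreasing compact connected subsets of the arc
`s₀`, so their intersection is nonempty, and if it were not a single point it would contain a
nonempty open set `U`. All points of `U` share the itinerary `s`, so mixing forces every element of
`P` to be the value of `sₘ` for all large `m`, that is, `P = {α}`. As the complement of the closed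
set `α` is then countable, `f` maps the arc `α` injectively into itself, so `f ∘ f` is increasing
along `α` and cannot leave one of the two sides of a point, which contradicts mixing.

A point outside `Q` visits arc interiors only, hence has exactly one itinerary. A point of `Q` has
countably many: once an orbit hits an endpoint of an arc of the partition, it stays among such
endpoints, and the image of an arc starts with only one arc of the partition. Finally, an invariant
probability measure carried by a countable set is carried by finitely many points up to an
arbitrarily small mass, and finitely many points see a bounded number of words of each length.
-/

namespace TameGraph

section Entropy

lemma log_natCast_mono : Monotone fun n : ℕ => Real.log n := by
  intro m n hmn
  rcases m.eq_zero_or_pos with rfl | hm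
  · simpa using Real.log_natCast_nonneg n
  · exact Real.log_le_log (by exact_mod_cast hm) (by exact_mod_cast hmn)

lemma sum_negMulLog_le {ι : Type*} (A : Finset ι) {p : ι → ℝ} (hp : ∀ i ∈ A, 0 ≤ p i) :
    ∑ i ∈ A, Real.negMulLog (p i) ≤
      Real.negMulLog (∑ i ∈ A, p i) + (∑ i ∈ A, p i) * Real.log A.card := by
  rcases A.eq_empty_or_nonempty with rfl | hA
  · simp
  have hcard : (0 : ℝ) < A.card := by exact_mod_cast hA.card_pos
  have jensen := Real.concaveOn_negMulLog.le_map_sum (t := A) (w := fun _ => (A.card : ℝ)⁻¹)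
    (fun _ _ => by positivity) (by simp [hcard.ne']) hp
  simp only [smul_eq_mul, ← Finset.mul_sum, Real.negMulLog_mul] at jensen
  calc ∑ i ∈ A, Real.negMulLog (p i)
      = A.card * ((A.card : ℝ)⁻¹ * ∑ i ∈ A, Real.negMulLog (p i)) := by field_simp
    _ ≤ A.card * ((∑ i ∈ A, p i) * Real.negMulLog (A.card : ℝ)⁻¹ +
          (A.card : ℝ)⁻¹ * Real.negMulLog (∑ i ∈ A, p i)) :=
        mul_le_mul_of_nonneg_left jensen hcard.le
    _ = Real.negMulLog (∑ i ∈ A, p i) + (∑ i ∈ A, p i) * Real.log A.card := by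
        simp only [Real.negMulLog, Real.log_inv]
        field_simp
        ring

variable {X : Type*} [MeasurableSpace X] {μ : Measure X}

/-- The Shannon entropy of the finite partition of `X` into the fibres of `g`. The block entropies
of a dynamical system arise from the maps `g` that read off the first `n` labels of an orbit. -/
noncomputable def fibreEntropy {ι : Type*} [Fintype ι] (μ : Measure X) (g : X → ι) : ℝ :=
  ∑ w, Real.negMulLog (μ.real (g ⁻¹' {w}))

lemma fibreEntropy_le {ι : Type*} [Fintype ι] [MeasurableSpace ι] [MeasurableSingletonClass ι]
    [IsProbabilityMeasure μ] {g : X → ι} (hg : Measurable g) (A : Finset ι) :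
    fibreEntropy μ g ≤
      1 + Real.log A.card + (1 - μ.real (g ⁻¹' A)) * Real.log (Fintype.card ι) := by
  classical
  set p := μ.real (g ⁻¹' A)
  have hp0 : 0 ≤ p := measureReal_nonneg
  have hp1 : p ≤ 1 := measureReal_le_one
  have sum_real (B : Finset ι) : ∑ w ∈ B, μ.real (g ⁻¹' {w}) = μ.real (g ⁻¹' B) :=
    sum_measureReal_preimage_singleton B fun w _ => hg (measurableSet_singleton w)
  have hcompl : μ.real (g ⁻¹' (Aᶜ : Finset ι)) = 1 - p := by
    rw [Finset.coe_compl, preimage_compl, probReal_compl_eq_one_sub (hg A.measurableSet)]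
  have entropy_A : ∑ w ∈ A, Real.negMulLog (μ.real (g ⁻¹' {w})) ≤ (1 - p) + Real.log A.card := by
    have := sum_negMulLog_le A fun w _ => measureReal_nonneg (μ := μ) (s := g ⁻¹' {w})
    rw [sum_real] at this
    exact this.trans (add_le_add (Real.negMulLog_le_one_sub_self hp0)
      (mul_le_of_le_one_left (Real.log_natCast_nonneg _) hp1))
  have entropy_compl : ∑ w ∈ Aᶜ, Real.negMulLog (μ.real (g ⁻¹' {w})) ≤
      p + (1 - p) * Real.log (Fintype.card ι) := by
    have := sum_negMulLog_le Aᶜ fun w _ => measureReal_nonneg (μ := μ) (s := g ⁻¹' {w})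
    rw [sum_real, hcompl] at this
    refine this.trans (add_le_add ?_
      (mul_le_mul_of_nonneg_left (log_natCast_mono (Finset.card_le_univ Aᶜ)) (by linarith)))
    linarith [Real.negMulLog_le_one_sub_self (x := 1 - p) (by linarith)]
  rw [fibreEntropy, ← Finset.sum_add_sum_compl A]
  linarith

variable {T : X → X} {k : ℕ} {ξ : X → Fin k}

lemma blockEntropy_eq_fibreEntropy (n : ℕ) :
    blockEntropy μ T ξ n = fibreEntropy μ fun x (j : Fin n) => ξ (T^[j] x) := by
  simp only [blockEntropy, fibreEntropy, preimage, mem_singleton_iff, funext_iff]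

lemma blockEntropy_le [IsProbabilityMeasure μ] (hT : Measurable T) (hξ : Measurable ξ)
    (F : Finset X) (n : ℕ) :
    blockEntropy μ T ξ n ≤ 1 + Real.log F.card + (1 - μ.real F) * (n * Real.log k) := by
  classical
  set word : X → Fin n → Fin k := fun x j => ξ (T^[j] x)
  have hword : Measurable word := measurable_pi_lambda _ fun j => hξ.comp (hT.iterate _)
  have hF : μ.real F ≤ μ.real (word ⁻¹' F.image word) :=
    measureReal_mono fun x hx => Finset.mem_image_of_mem word hx
  have hcard : Real.log (Fintype.card (Fin n → Fin k)) = n * Real.log k := by simp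
  calc blockEntropy μ T ξ n = fibreEntropy μ word := blockEntropy_eq_fibreEntropy n
    _ ≤ 1 + Real.log (F.image word).card +
          (1 - μ.real (word ⁻¹' F.image word)) * (n * Real.log k) :=
        hcard ▸ fibreEntropy_le hword _
    _ ≤ 1 + Real.log F.card + (1 - μ.real F) * (n * Real.log k) := by
        have hlog : Real.log (F.image word).card ≤ Real.log F.card :=
          log_natCast_mono Finset.card_image_le
        have := Real.log_natCast_nonneg k
        gcongr

lemma limsup_blockEntropy_le [IsProbabilityMeasure μ] (hT : Measurable T) (hξ : Measurable ξ)
    (F : Finset X) :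
    limsup (fun n : ℕ => ENNReal.ofReal (blockEntropy μ T ξ n / n)) atTop ≤
      ENNReal.ofReal ((1 - μ.real F) * Real.log k) := by
  have hlim : Tendsto (fun n : ℕ => ENNReal.ofReal
      ((1 + Real.log F.card) / n + (1 - μ.real F) * Real.log k)) atTop
      (𝓝 (ENNReal.ofReal ((1 - μ.real F) * Real.log k))) := by
    simpa using ENNReal.tendsto_ofReal
      ((tendsto_const_div_atTop_nhds_zero_nat (1 + Real.log F.card)).add_const
        ((1 - μ.real F) * Real.log k))
  rw [← hlim.limsup_eq]
  refine limsup_le_limsup ?_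
  filter_upwards [eventually_gt_atTop 0] with n hn
  have hn' : (0 : ℝ) < n := by exact_mod_cast hn
  refine ENNReal.ofReal_le_ofReal ((div_le_div_of_nonneg_right
    (blockEntropy_le hT hξ F n) hn'.le).trans_eq ?_)
  field_simp

lemma tendsto_measure_finset_of_countable (μ : Measure X) {N : Set X} (hN : N.Countable) :
    Tendsto (fun F : Finset N => μ (F.map (.subtype _) : Finset X)) atTop (𝓝 (μ N)) := by
  have : Countable N := hN.to_subtype
  have hmono : Monotone fun F : Finset N => ((F.map (.subtype _) : Finset X) : Set X) :=
    fun _ _ h => Finset.coe_subset.2 (Finset.map_subset_map.2 h)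
  have hUnion : ⋃ F : Finset N, ((F.map (.subtype _) : Finset X) : Set X) = N := by
    refine Subset.antisymm (iUnion_subset fun F => ?_) fun x hx => mem_iUnion.2 ⟨{⟨x, hx⟩}, by simp⟩
    simp [Finset.coe_map]
  have := tendsto_measure_iUnion_atTop (μ := μ) hmono
  rwa [hUnion] at this

theorem measureEntropy_eq_zero_of_countable [IsProbabilityMeasure μ] (hT : Measurable T)
    {N : Set X} (hN : N.Countable) (hμ : μ Nᶜ = 0) : measureEntropy μ T = 0 := by
  simp only [measureEntropy, ENNReal.iSup_eq_zero]
  intro k ξ hξ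
  have hfull : μ N = 1 := by rw [measure_of_measure_compl_eq_zero hμ, measure_univ]
  have hmass := (ENNReal.tendsto_toReal (by simp [hfull])).comp
    (tendsto_measure_finset_of_countable μ hN)
  have hlim := ENNReal.tendsto_ofReal ((hmass.const_sub 1).mul_const (Real.log k))
  rw [hfull, ENNReal.toReal_one, sub_self, zero_mul, ENNReal.ofReal_zero] at hlim
  exact nonpos_iff_eq_zero.1 (ge_of_tendsto' hlim fun F => limsup_blockEntropy_le hT hξ _)

theorem isSmall_of_countable {N : Set X} (hm : MeasurableSet N) (hN : N.Countable)
    (hT : T ⁻¹' N ⊆ N) : IsSmall T N where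
  measurable := hm
  backward := hT
  entropy _ _ hμ h := measureEntropy_eq_zero_of_countable hμ.measurable hN h

variable {Y : Type*} [MeasurableSpace Y] {S : Y → Y} {N : Set X} {N' : Set Y}
  {e : ↥(Nᶜ) ≃ᵐ ↥(N'ᶜ)}

lemma IsIsoModSmall.symm (h : IsIsoModSmall T S N N' e) : IsIsoModSmall S T N' N e.symm where
  small_source := h.small_target
  small_target := h.small_source
  intertwine y y' hy := by
    let Tx : ↥(Nᶜ) := ⟨T (e.symm y), fun hN => (e.symm y).2 (h.small_source.backward hN)⟩
    have hTx : e Tx = y' := Subtype.ext <| by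
      rw [← h.intertwine (e.symm y) Tx rfl, e.apply_symm_apply, hy]
    rw [← hTx, e.symm_apply_apply]

end Entropy

section General

variable {X Y Z : Type*} [TopologicalSpace X] [TopologicalSpace Y] [TopologicalSpace Z]

lemma exists_continuous_injective_lift {a : Y → X} {b : Z → X} (ha : IsEmbedding a)
    (hb : Continuous b) (hbi : Function.Injective b) (hab : range b ⊆ range a) :
    ∃ h : Z → Y, Continuous h ∧ Function.Injective h ∧ ∀ t, a (h t) = b t := by
  choose h hh using fun t => hab (mem_range_self t)
  refine ⟨h, ha.continuous_iff.2 ?_, fun s t hst => hbi ?_, hh⟩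
  · simpa only [Function.comp_def, hh] using hb
  · rw [← hh s, ← hh t, hst]

lemma isOpen_image_of_subset {γ : Y → X} (hγ : IsInducing γ) {U W : Set Y}
    (hW : IsOpen (γ '' W)) (hU : IsOpen U) (hUW : U ⊆ W) : IsOpen (γ '' U) := by
  obtain ⟨V, hV, rfl⟩ := hγ.isOpen_iff.1 hU
  rw [← inter_eq_right.2 hUW, image_inter_preimage]
  exact hW.inter hV

lemma isPreconnected_preimage_of_subset_range {γ : Y → X} (hγ : IsInducing γ) {C : Set X}
    (hC : IsPreconnected C) (hsub : C ⊆ range γ) : IsPreconnected (γ ⁻¹' C) := by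
  rwa [← hγ.isPreconnected_image, image_preimage_eq_of_subset hsub]

lemma isConnected_inter_preimage {f : X → Y} {A : Set X} (hf : IsInducing (A.domRestrict f))
    {C : Set Y} (hC : IsConnected C) (hsub : C ⊆ f '' A) : IsConnected (A ∩ f ⁻¹' C) := by
  rw [← range_domRestrict] at hsub
  have hpre : IsConnected (A.domRestrict f ⁻¹' C) :=
    ⟨hC.nonempty.preimage' hsub, isPreconnected_preimage_of_subset_range hf hC.isPreconnected hsub⟩
  rw [← Subtype.image_preimage_coe]
  exact hpre.image Subtype.val continuous_subtype_val.continuousOn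

lemma dense_compl_of_countable [T1Space X] [BaireSpace X] [PerfectSpace X] {s : Set X}
    (hs : s.Countable) : Dense sᶜ := by
  rw [← biUnion_of_singleton s, compl_iUnion₂]
  exact dense_biInter_of_isOpen (fun _ _ => isOpen_compl_singleton) hs
    fun x _ => dense_compl_singleton x

end General

section Arcs

variable {X : Type*} [TopologicalSpace X]

lemma eq_zero_or_eq_one_of_map_eq_zero {h : unitInterval → unitInterval} (hc : Continuous h)
    (hi : Function.Injective h) {t : unitInterval} (ht : h t = 0) : t = 0 ∨ t = 1 := by
  rcases hc.strictMono_of_inj hi with hm | hm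
  · exact Or.inl (le_bot_iff.1 (hm.le_iff_le.1 (ht.trans_le unitInterval.nonneg')))
  · exact Or.inr (top_le_iff.1 (hm.le_iff_ge.1 (ht.trans_le unitInterval.nonneg')))

lemma apply_zero_mem_pair_of_range_subset {γ δ : unitInterval → X} (hγ : IsEmbedding γ)
    (hδ : IsEmbedding δ) (hsub : range γ ⊆ range δ) (h0 : δ 0 ∈ range γ) :
    δ 0 ∈ ({γ 0, γ 1} : Set X) := by
  obtain ⟨h, hc, hi, hh⟩ := exists_continuous_injective_lift hδ hγ.continuous hγ.injective hsub
  obtain ⟨t, ht⟩ := h0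
  rcases eq_zero_or_eq_one_of_map_eq_zero hc hi (hδ.injective ((hh t).trans ht)) with rfl | rfl
  · exact Or.inl ht.symm
  · exact Or.inr ht.symm

lemma arcEnds_range {γ : unitInterval → X} (hγ : IsEmbedding γ) :
    arcEnds (range γ) = {γ 0, γ 1} := by
  refine Subset.antisymm ?_ (pair_subset ⟨γ, hγ, rfl, rfl⟩ ?_)
  · rintro _ ⟨δ, hδ, hr, rfl⟩
    exact apply_zero_mem_pair_of_range_subset hγ hδ hr.ge (hr ▸ mem_range_self 0)
  · exact ⟨γ ∘ unitInterval.symmHomeomorph, hγ.comp unitInterval.symmHomeomorph.isEmbedding,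
      unitInterval.symmHomeomorph.surjective.range_comp γ, by simp⟩

lemma arcInterior_range {γ : unitInterval → X} (hγ : IsEmbedding γ) :
    arcInterior (range γ) = γ '' Ioo 0 1 := by
  have hIoo : Ioo (0 : unitInterval) 1 = univ \ {0, 1} := by
    ext t
    simp [unitInterval.pos_iff_ne_zero, unitInterval.lt_one_iff_ne_one]
  rw [arcInterior, arcEnds_range hγ, hIoo, image_sdiff hγ.injective, image_univ, image_pair]

variable {α β : Set X}

lemma IsArc.isCompact (h : IsArc α) : IsCompact α := by
  obtain ⟨γ, hγ, rfl⟩ := h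
  exact isCompact_range hγ.continuous

lemma IsArc.isConnected (h : IsArc α) : IsConnected α := by
  obtain ⟨γ, hγ, rfl⟩ := h
  exact isConnected_range hγ.continuous

lemma IsArc.nontrivial (h : IsArc α) : α.Nontrivial := by
  obtain ⟨γ, hγ, rfl⟩ := h
  exact ⟨γ 0, mem_range_self 0, γ 1, mem_range_self 1, hγ.injective.ne zero_ne_one⟩

lemma IsArc.finite_arcEnds (h : IsArc α) : (arcEnds α).Finite := by
  obtain ⟨γ, hγ, rfl⟩ := h
  rw [arcEnds_range hγ]
  exact toFinite _

lemma IsArc.subset_closure_arcInterior (h : IsArc α) : α ⊆ closure (arcInterior α) := by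
  obtain ⟨γ, hγ, rfl⟩ := h
  rw [arcInterior_range hγ]
  refine Subset.trans ?_ (image_closure_subset_closure_image hγ.continuous)
  rw [closure_Ioo zero_ne_one, ← unitInterval.univ_eq_Icc, image_univ]

lemma IsArc.nonempty_arcInterior (h : IsArc α) : (arcInterior α).Nonempty :=
  closure_nonempty_iff.1 (h.isConnected.nonempty.mono h.subset_closure_arcInterior)

lemma IsArc.subset_of_countable_sdiff (h : IsArc α) {F : Set X} (hF : IsClosed F)
    (hc : (α \ F).Countable) : α ⊆ F := by
  obtain ⟨γ, hγ, rfl⟩ := h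
  have hmaps : MapsTo γ (γ ⁻¹' Fᶜ) (range γ \ F) := fun t ht => ⟨mem_range_self t, ht⟩
  have hcount : (γ ⁻¹' Fᶜ).Countable := hmaps.countable_of_injOn hγ.injective.injOn hc
  have hdense : Dense (γ ⁻¹' F) := by simpa using dense_compl_of_countable hcount
  have huniv : γ ⁻¹' F = univ := by
    rw [← (hF.preimage hγ.continuous).closure_eq, hdense.closure_eq]
  exact range_subset_iff.2 (eq_univ_iff_forall.1 huniv)

lemma IsArc.mem_arcEnds_of_subset (hβ : IsArc β) (hβα : β ⊆ α) {p : X} (hp : p ∈ arcEnds α)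
    (hpβ : p ∈ β) : p ∈ arcEnds β := by
  obtain ⟨a, ha, rfl, rfl⟩ := hp
  obtain ⟨b, hb, rfl⟩ := hβ
  rw [arcEnds_range hb]
  exact apply_zero_mem_pair_of_range_subset hb ha hβα hpβ

lemma exists_image_Icc_subset_of_isPreconnected {γ : unitInterval → X} (hγ : IsInducing γ)
    {C : Set X} (hC : IsPreconnected C) (hnt : C.Nontrivial) (hsub : C ⊆ range γ)
    (h0 : γ 0 ∈ C) : ∃ t > 0, γ '' Icc 0 t ⊆ C := by
  obtain ⟨x, hx, hx0⟩ := hnt.exists_ne (γ 0)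
  obtain ⟨t, rfl⟩ := hsub hx
  exact ⟨t, unitInterval.pos_iff_ne_zero.2 fun h => hx0 (h ▸ rfl),
    image_subset_iff.2 ((isPreconnected_preimage_of_subset_range hγ hC hsub).Icc_subset h0 hx)⟩

lemma infinite_inter_of_mem_arcEnds {C D : Set X} {p : X} (hp : p ∈ arcEnds α)
    (hC : IsPreconnected C) (hCnt : C.Nontrivial) (hCα : C ⊆ α) (hpC : p ∈ C)
    (hD : IsPreconnected D) (hDnt : D.Nontrivial) (hDα : D ⊆ α) (hpD : p ∈ D) :
    (C ∩ D).Infinite := by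
  obtain ⟨γ, hγ, rfl, rfl⟩ := hp
  obtain ⟨s, hs, hsC⟩ :=
    exists_image_Icc_subset_of_isPreconnected hγ.isInducing hC hCnt hCα hpC
  obtain ⟨t, ht, htD⟩ :=
    exists_image_Icc_subset_of_isPreconnected hγ.isInducing hD hDnt hDα hpD
  refine ((Icc_infinite (lt_min hs ht)).image hγ.injective.injOn).mono (subset_inter ?_ ?_)
  · exact (image_mono (Icc_subset_Icc_right (min_le_left s t))).trans hsC
  · exact (image_mono (Icc_subset_Icc_right (min_le_right s t))).trans htD

section Image

variable {Y : Type*} [TopologicalSpace Y] {f : X → Y}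

lemma isEmbedding_comp_of_domRestrict_range {γ : unitInterval → X} (hγ : IsEmbedding γ)
    (hf : IsEmbedding ((range γ).domRestrict f)) : IsEmbedding (f ∘ γ) :=
  hf.comp (hγ.codRestrict _ mem_range_self)

lemma IsArc.image (hα : IsArc α) (hf : IsEmbedding (α.domRestrict f)) : IsArc (f '' α) := by
  obtain ⟨γ, hγ, rfl⟩ := hα
  exact ⟨f ∘ γ, isEmbedding_comp_of_domRestrict_range hγ hf, range_comp f γ⟩

lemma apply_mem_arcEnds_image (hf : IsEmbedding (α.domRestrict f)) {p : X}
    (hp : p ∈ arcEnds α) : f p ∈ arcEnds (f '' α) := by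
  obtain ⟨γ, hγ, rfl, rfl⟩ := hp
  exact ⟨f ∘ γ, isEmbedding_comp_of_domRestrict_range hγ hf, range_comp f γ, rfl⟩

end Image

lemma IsFreeArc.nonempty_interior_iInter (hα : IsFreeArc α) {ι : Type*} [Nonempty ι]
    {C : ι → Set X} (hC : ∀ n, IsPreconnected (C n)) (hsub : ∀ n, C n ⊆ α)
    (hnt : (⋂ n, C n).Nontrivial) : (interior (⋂ n, C n)).Nonempty := by
  obtain ⟨⟨γ, hγ, rfl⟩, hopen⟩ := hα
  rw [arcInterior_range hγ] at hopen
  have hord : (γ ⁻¹' ⋂ n, C n).OrdConnected := by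
    rw [preimage_iInter]
    exact ordConnected_iInter fun n =>
      (isPreconnected_preimage_of_subset_range hγ.isInducing (hC n) (hsub n)).ordConnected
  have himage : γ '' (γ ⁻¹' ⋂ n, C n) = ⋂ n, C n :=
    image_preimage_eq_of_subset (iInter_subset_of_subset (Classical.arbitrary ι) (hsub _))
  obtain ⟨s, hs, t, ht, hst⟩ := (nontrivial_of_image γ _ (himage.symm ▸ hnt)).exists_lt
  refine ((nonempty_Ioo.2 hst).image γ).mono (interior_maximal ?_ ?_)
  · exact image_subset_iff.2 (Ioo_subset_Icc_self.trans (hord.out hs ht))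
  · exact isOpen_image_of_subset hγ.isInducing hopen isOpen_Ioo
      (Ioo_subset_Ioo unitInterval.nonneg' unitInterval.le_one')

end Arcs

section Mixing

variable {X : Type*} [TopologicalSpace X] {f : X → X}

lemma IsTopMixing.inter_nonempty_of_mapsTo_iterate (hmix : IsTopMixing f) {k : ℕ} (hk : k ≠ 0)
    {U V : Set X} (hU : IsOpen U) (hUne : U.Nonempty) (hV : IsOpen V) (hVne : V.Nonempty)
    (hmaps : MapsTo f^[k] U U) : (U ∩ V).Nonempty := by
  obtain ⟨n, hn⟩ := hmix U V hU hUne hV hVne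
  have hinv : f^[k * n] '' U ⊆ U := by
    rw [Function.iterate_mul]
    exact (hmaps.iterate n).image_subset
  exact (hn (k * n) (Nat.le_mul_of_pos_left n (Nat.pos_of_ne_zero hk))).mono
    (inter_subset_inter_left V hinv)

lemma mapsTo_Ioo_bot_or_Ioo_top_of_strictMono {α : Type*} [LinearOrder α] [BoundedOrder α]
    {h : α → α} (hm : StrictMono h) (c : α) :
    MapsTo h (Ioo ⊥ c) (Ioo ⊥ c) ∨ MapsTo h (Ioo c ⊤) (Ioo c ⊤) := by
  rcases le_total (h c) c with hc | hc
  · exact Or.inl fun x hx => ⟨bot_le.trans_lt (hm hx.1), (hm hx.2).trans_le hc⟩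
  · exact Or.inr fun x hx => ⟨hc.trans_lt (hm hx.1), (hm hx.2).trans_le le_top⟩

theorem IsFreeArc.not_mapsTo_of_isTopMixing {α : Set X} (hα : IsFreeArc α)
    (hf : ContinuousOn f α) (hinj : InjOn f α) (hmix : IsTopMixing f) : ¬ MapsTo f α α := by
  intro hmaps
  obtain ⟨⟨γ, hγ, rfl⟩, hopen⟩ := hα
  rw [arcInterior_range hγ] at hopen
  obtain ⟨g, hg, hgi, hγg⟩ := exists_continuous_injective_lift hγ
    (hf.comp_continuous hγ.continuous mem_range_self)
    (fun s t h => hγ.injective (hinj (mem_range_self s) (mem_range_self t) h))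
    (range_subset_iff.2 fun t => hmaps (mem_range_self t))
  have hmono : StrictMono (g ∘ g) :=
    (hg.strictMono_of_inj hgi).elim (fun h => h.comp h) fun h => h.comp h
  have mapsTo_image {U : Set unitInterval} (h : MapsTo (g ∘ g) U U) :
      MapsTo f^[2] (γ '' U) (γ '' U) := by
    rintro _ ⟨t, ht, rfl⟩
    exact ⟨g (g t), h ht, by simp [hγg]⟩
  obtain ⟨c, hc0, hc1⟩ := exists_between (zero_lt_one (α := unitInterval))
  have hL : IsOpen (γ '' Ioo 0 c) :=
    isOpen_image_of_subset hγ.isInducing hopen isOpen_Ioo (Ioo_subset_Ioo_right hc1.le)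
  have hR : IsOpen (γ '' Ioo c 1) :=
    isOpen_image_of_subset hγ.isInducing hopen isOpen_Ioo (Ioo_subset_Ioo_left hc0.le)
  have hLne : (γ '' Ioo 0 c).Nonempty := (nonempty_Ioo.2 hc0).image γ
  have hRne : (γ '' Ioo c 1).Nonempty := (nonempty_Ioo.2 hc1).image γ
  have hdisj : Disjoint (γ '' Ioo 0 c) (γ '' Ioo c 1) :=
    disjoint_image_of_injective hγ.injective <|
      disjoint_left.2 fun _ hl hr => lt_asymm hl.2 hr.1
  rcases mapsTo_Ioo_bot_or_Ioo_top_of_strictMono hmono c with h | h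
  · exact (hmix.inter_nonempty_of_mapsTo_iterate two_ne_zero hL hLne hR hRne
      (mapsTo_image h)).not_disjoint hdisj
  · exact (hmix.inter_nonempty_of_mapsTo_iterate two_ne_zero hR hRne hL hLne
      (mapsTo_image h)).not_disjoint hdisj.symm

end Mixing

section Partitions

variable {X : Type*} [TopologicalSpace X] {f : X → X} {P : Set (Set X)} {i j : Set X}

lemma IsTamePartition.isArc (hP : IsTamePartition P) (hi : i ∈ P) : IsArc i :=
  (hP.freeArc i hi).1

lemma IsTamePartition.isOpen_arcInterior (hP : IsTamePartition P) (hi : i ∈ P) :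
    IsOpen (arcInterior i) :=
  (hP.freeArc i hi).2

lemma IsTamePartition.disjoint_arcInterior (hP : IsTamePartition P) (hi : i ∈ P) (hj : j ∈ P)
    (hij : i ≠ j) : Disjoint i (arcInterior j) :=
  ((hP.disjoint i hi j hj hij).closure_left (hP.isOpen_arcInterior hj)).mono_left
    (hP.isArc hi).subset_closure_arcInterior

lemma IsTamePartition.eq_of_mem_arcInterior (hP : IsTamePartition P) (hi : i ∈ P) (hj : j ∈ P)
    {x : X} (hxi : x ∈ i) (hxj : x ∈ arcInterior j) : i = j := by
  by_contra hij
  exact disjoint_left.1 (hP.disjoint_arcInterior hi hj hij) hxi hxj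

lemma IsTamePartition.finite_inter (hP : IsTamePartition P) (hi : i ∈ P) (hj : j ∈ P)
    (hij : i ≠ j) : (i ∩ j).Finite := by
  refine (hP.isArc hj).finite_arcEnds.subset fun x hx => ?_
  by_contra hend
  exact disjoint_left.1 (hP.disjoint_arcInterior hi hj hij) hx.1 ⟨hx.2, hend⟩

lemma IsTamePartition.eq_of_mem_arcEnds (hP : IsTamePartition P) (hi : i ∈ P) (hj : j ∈ P)
    {α : Set X} {p : X} (hp : p ∈ arcEnds α) (hiα : i ⊆ α) (hjα : j ⊆ α) (hpi : p ∈ i)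
    (hpj : p ∈ j) : i = j := by
  by_contra hij
  exact infinite_inter_of_mem_arcEnds hp
    (hP.isArc hi).isConnected.isPreconnected (hP.isArc hi).nontrivial hiα hpi
    (hP.isArc hj).isConnected.isPreconnected (hP.isArc hj).nontrivial hjα hpj
    (hP.finite_inter hi hj hij)

lemma IsTamePartition.countable_of_forall_inter (hP : IsTamePartition P) {S : Set X}
    (hS : ∀ i ∈ P, (S ∩ i).Countable) : S.Countable := by
  refine (hP.cover.union (hP.countable.biUnion hS)).mono fun x hx => ?_
  rw [← inter_iUnion₂, ← sUnion_eq_biUnion]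
  by_cases h : x ∈ ⋃₀ P
  · exact Or.inr ⟨hx, h⟩
  · exact Or.inl h

lemma mem_arcEnds_of_mem_partitionPoints {x : X} (hx : x ∈ partitionPoints P) (hi : i ∈ P)
    (hxi : x ∈ i) : x ∈ arcEnds i := by
  by_contra hend
  exact hx (mem_biUnion hi ⟨hxi, hend⟩)

lemma IsTamePartition.countable_partitionPoints (hP : IsTamePartition P) :
    (partitionPoints P).Countable :=
  hP.countable_of_forall_inter fun _ hi => (hP.isArc hi).finite_arcEnds.countable.mono
    fun _ hx => mem_arcEnds_of_mem_partitionPoints hx.1 hi hx.2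

lemma IsMarkovPartition.injOn (hP : IsMarkovPartition f P) (hi : i ∈ P) : InjOn f i :=
  injOn_iff_injective.2 (hP.monotone i hi).injective

lemma IsMarkovPartition.countable_preimage (hP : IsMarkovPartition f P) {S : Set X}
    (hS : S.Countable) : (f ⁻¹' S).Countable :=
  hP.tame.countable_of_forall_inter fun _ hi =>
    MapsTo.countable_of_injOn (f := f) (fun _ hx => hx.1) ((hP.injOn hi).mono inter_subset_right)
      hS

lemma IsMarkovPartition.countable_exceptionalSet (hP : IsMarkovPartition f P) :
    (exceptionalSet f P).Countable := by
  refine countable_iUnion fun n => ?_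
  induction n with
  | zero => exact hP.tame.countable_partitionPoints
  | succ n ih =>
    rw [Function.iterate_succ, preimage_comp]
    exact hP.countable_preimage ih

lemma preimage_exceptionalSet_subset : f ⁻¹' exceptionalSet f P ⊆ exceptionalSet f P := by
  intro x hx
  obtain ⟨n, hn⟩ := mem_iUnion.1 hx
  exact mem_iUnion.2 ⟨n + 1, hn⟩

lemma notMem_exceptionalSet_iff {x : X} :
    x ∉ exceptionalSet f P ↔ ∀ n, ∃ i : P, f^[n] x ∈ arcInterior (i : Set X) := by
  simp [exceptionalSet, partitionPoints]

theorem IsMarkovPartition.nontrivial [T2Space X] (hP : IsMarkovPartition f P)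
    (hmix : IsTopMixing f) (hne : P.Nonempty) : P.Nontrivial := by
  obtain ⟨α, hα⟩ := hne
  by_contra hnt
  obtain rfl : P = {α} := (not_nontrivial_iff.1 hnt).eq_singleton_of_mem hα
  have hcover : αᶜ.Countable := by simpa using hP.tame.cover
  have harc := hP.tame.isArc hα
  have hmaps : f '' α ⊆ α := (harc.image (hP.monotone α hα)).subset_of_countable_sdiff
    harc.isCompact.isClosed (hcover.mono fun _ hx => hx.2)
  exact (hP.tame.freeArc α hα).not_mapsTo_of_isTopMixing
    (continuousOn_iff_continuous_domRestrict.2 (hP.monotone α hα).continuous) (hP.injOn hα) hmix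
    (mapsTo_iff_image_subset.2 hmaps)

lemma IsTamePartition.eventually_eq_of_forall_mapsTo_iterate (hP : IsTamePartition P)
    (hmix : IsTopMixing f) {U : Set X} (hU : IsOpen U) (hUne : U.Nonempty) {s : ℕ → Set X}
    (hs : ∀ n, s n ∈ P) (hmaps : ∀ n, MapsTo f^[n] U (s n)) (hj : j ∈ P) :
    ∀ᶠ n in atTop, s n = j := by
  obtain ⟨n, hn⟩ := hmix U (arcInterior j) hU hUne (hP.isOpen_arcInterior hj)
    (hP.isArc hj).nonempty_arcInterior
  refine eventually_atTop.2 ⟨n, fun m hm => ?_⟩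
  obtain ⟨_, ⟨x, hx, rfl⟩, hxj⟩ := hn m hm
  exact hP.eq_of_mem_arcInterior (hs m) hj (hmaps m hx) hxj

end Partitions

section Cylinders

variable {X : Type*} {f : X → X} {i : ℕ → Set X}

lemma cylinder_zero : cylinder f i 0 = i 0 := by
  simp [cylinder]

lemma cylinder_succ (n : ℕ) :
    cylinder f i (n + 1) = i 0 ∩ f ⁻¹' cylinder f (fun k => i (k + 1)) n := by
  ext x
  simp only [cylinder, mem_iInter, mem_preimage, mem_inter_iff]
  constructor
  · exact fun h => ⟨h 0 (Nat.zero_le _), fun k hk => h (k + 1) (by omega)⟩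
  · rintro ⟨h0, h⟩ (_ | k) hk
    · exact h0
    · exact h k (by omega)

lemma antitone_cylinder : Antitone (cylinder f i) :=
  fun _ _ h => biInter_subset_biInter_left fun _ hk => le_trans hk h

lemma cylinder_subset (n : ℕ) : cylinder f i n ⊆ i 0 :=
  (antitone_cylinder n.zero_le).trans cylinder_zero.subset

lemma mem_iInter_cylinder {x : X} : x ∈ ⋂ n, cylinder f i n ↔ ∀ n, f^[n] x ∈ i n := by
  simp only [cylinder, mem_iInter, mem_preimage]
  exact ⟨fun h n => h n n le_rfl, fun h _ k _ => h k⟩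

variable [TopologicalSpace X]

lemma isConnected_cylinder (hi : ∀ n, IsConnected (i n))
    (hf : ∀ n, IsInducing ((i n).domRestrict f)) (hif : ∀ n, i (n + 1) ⊆ f '' i n) (n : ℕ) :
    IsConnected (cylinder f i n) := by
  induction n generalizing i with
  | zero => rw [cylinder_zero]; exact hi 0
  | succ n ih =>
    rw [cylinder_succ]
    exact isConnected_inter_preimage (hf 0) (ih (fun k => hi _) (fun k => hf _) fun k => hif _)
      ((cylinder_subset n).trans (hif 0))

lemma isClosed_cylinder (hi : ∀ n, IsClosed (i n)) (hf : Continuous f) (n : ℕ) :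
    IsClosed (cylinder f i n) :=
  isClosed_biInter fun k _ => (hi k).preimage (hf.iterate k)

lemma isCompact_cylinder [T2Space X] (hi : ∀ n, IsCompact (i n)) (hf : Continuous f) (n : ℕ) :
    IsCompact (cylinder f i n) :=
  (hi 0).of_isClosed_subset (isClosed_cylinder (fun k => (hi k).isClosed) hf n) (cylinder_subset n)

variable {P : Set (Set X)}

lemma IsMarkovPartition.isConnected_cylinder (hP : IsMarkovPartition f P) (hi : ∀ n, i n ∈ P)
    (hif : ∀ n, i (n + 1) ⊆ f '' i n) (n : ℕ) : IsConnected (cylinder f i n) :=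
  TameGraph.isConnected_cylinder (fun k => (hP.tame.isArc (hi k)).isConnected)
    (fun k => (hP.monotone _ (hi k)).isInducing) hif n

lemma IsMarkovPartition.nonempty_iInter_cylinder [T2Space X] (hP : IsMarkovPartition f P)
    (hf : Continuous f) (hi : ∀ n, i n ∈ P) (hif : ∀ n, i (n + 1) ⊆ f '' i n) :
    (⋂ n, cylinder f i n).Nonempty :=
  have hcompact := isCompact_cylinder (fun n => (hP.tame.isArc (hi n)).isCompact) hf
  IsCompact.nonempty_iInter_of_sequence_nonempty_isCompact_isClosed _
    (fun n => antitone_cylinder n.le_succ) (fun n => (hP.isConnected_cylinder hi hif n).nonempty)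
    (hcompact 0) fun n => (hcompact n).isClosed

lemma IsMarkovPartition.subsingleton_iInter_cylinder [T2Space X] (hP : IsMarkovPartition f P)
    (hmix : IsTopMixing f) (hi : ∀ n, i n ∈ P) (hif : ∀ n, i (n + 1) ⊆ f '' i n) :
    (⋂ n, cylinder f i n).Subsingleton := by
  rw [← not_nontrivial_iff]
  intro hnt
  have hopen : (interior (⋂ n, cylinder f i n)).Nonempty :=
    (hP.tame.freeArc _ (hi 0)).nonempty_interior_iInter
      (fun n => (hP.isConnected_cylinder hi hif n).isPreconnected) cylinder_subset hnt
  have hmaps (n : ℕ) : MapsTo f^[n] (interior (⋂ n, cylinder f i n)) (i n) :=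
    fun x hx => mem_iInter_cylinder.1 (interior_subset hx) n
  obtain ⟨α, hα, β, hβ, hαβ⟩ := hP.nontrivial hmix ⟨_, hi 0⟩
  obtain ⟨n, hnα, hnβ⟩ :=
    ((hP.tame.eventually_eq_of_forall_mapsTo_iterate hmix isOpen_interior hopen hi hmaps hα).and
      (hP.tame.eventually_eq_of_forall_mapsTo_iterate hmix isOpen_interior hopen hi hmaps
        hβ)).exists
  exact hαβ (hnα.symm.trans hnβ)

theorem IsMarkovPartition.exists_iInter_cylinder_eq_singleton [T2Space X]
    (hP : IsMarkovPartition f P) (hf : Continuous f) (hmix : IsTopMixing f) (hi : ∀ n, i n ∈ P)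
    (hif : ∀ n, i (n + 1) ⊆ f '' i n) : ∃ x, ⋂ n, cylinder f i n = {x} :=
  exists_eq_singleton_iff_nonempty_subsingleton.2
    ⟨hP.nonempty_iInter_cylinder hf hi hif, hP.subsingleton_iInter_cylinder hmix hi hif⟩

end Cylinders

section MarkovShift

variable {ι : Type*} {M : Matrix ι ι ℕ}

lemma MarkovShift.isOpen_setOf_apply_eq (n : ℕ) (a : ι) : IsOpen {s : MarkovShift M | s.1 n = a} :=
  let _ : TopologicalSpace ι := ⊥
  have : DiscreteTopology ι := ⟨rfl⟩
  have hcoord : Continuous fun s : MarkovShift M => s.1 n :=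
    (continuous_apply n).comp continuous_induced_dom
  (isOpen_discrete {a}).preimage hcoord

lemma MarkovShift.isOpen_setOf_forall_le_eq (s : ℕ → ι) (n : ℕ) :
    IsOpen {t : MarkovShift M | ∀ k ≤ n, t.1 k = s k} := by
  simp only [ofPred_forall]
  exact (finite_Iic n).isOpen_biInter fun k _ => isOpen_setOf_apply_eq k (s k)

lemma MarkovShift.continuous_of_isOpen {Y : Type*} [TopologicalSpace Y] {g : Y → MarkovShift M}
    (hg : ∀ n a, IsOpen {y | (g y).1 n = a}) : Continuous g := by
  let _ : TopologicalSpace ι := ⊥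
  have : DiscreteTopology ι := ⟨rfl⟩
  exact continuous_induced_rng.2 (continuous_pi fun n => continuous_discrete_rng.2 (hg n))

end MarkovShift

section Coding

variable {X : Type*} {f : X → X} {P : Set (Set X)}

lemma transitionMatrix_eq_one_iff {i j : P} :
    transitionMatrix f P i j = 1 ↔ (j : Set X) ⊆ f '' i := by
  simp [transitionMatrix]

lemma MarkovShift.subset_image (s : MarkovShift (transitionMatrix f P)) (n : ℕ) :
    (s.1 (n + 1) : Set X) ⊆ f '' s.1 n :=
  transitionMatrix_eq_one_iff.1 (s.2 n)

/-- `ψ` is the coding map of the partition `P`: it sends every admissible sequence of elements of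
`P` to the only point having this sequence as an itinerary. -/
def IsCoding (f : X → X) (P : Set (Set X)) (ψ : MarkovShift (transitionMatrix f P) → X) : Prop :=
  ∀ s, ⋂ n, cylinder f (fun k => (s.1 k : Set X)) n = {ψ s}

variable {ψ : MarkovShift (transitionMatrix f P) → X}

lemma IsCoding.iterate_mem (hψ : IsCoding f P ψ) (s : MarkovShift (transitionMatrix f P)) (n : ℕ) :
    f^[n] (ψ s) ∈ (s.1 n : Set X) :=
  mem_iInter_cylinder.1 ((hψ s).symm ▸ mem_singleton (ψ s)) n

lemma IsCoding.eq_of_forall_iterate_mem (hψ : IsCoding f P ψ)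
    {s : MarkovShift (transitionMatrix f P)} {x : X} (h : ∀ n, f^[n] x ∈ (s.1 n : Set X)) :
    ψ s = x :=
  (mem_singleton_iff.1 ((hψ s).subset (mem_iInter_cylinder.2 h))).symm

lemma IsCoding.apply_shift (hψ : IsCoding f P ψ) (s : MarkovShift (transitionMatrix f P)) :
    ψ (MarkovShift.shift _ s) = f (ψ s) :=
  hψ.eq_of_forall_iterate_mem fun n => hψ.iterate_mem s (n + 1)

variable [TopologicalSpace X]

theorem IsMarkovPartition.exists_isCoding [T2Space X] (hP : IsMarkovPartition f P)
    (hf : Continuous f) (hmix : IsTopMixing f) : ∃ ψ, IsCoding f P ψ :=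
  Classical.skolem.1 fun s =>
    hP.exists_iInter_cylinder_eq_singleton hf hmix (fun n => (s.1 n).2) s.subset_image

theorem IsCoding.continuous [T2Space X] (hψ : IsCoding f P ψ) (hP : IsTamePartition P)
    (hf : Continuous f) : Continuous ψ := by
  refine continuous_iff_continuousAt.2 fun s => tendsto_def.2 fun U hU => ?_
  have hcompact := isCompact_cylinder (fun k => (hP.isArc (s.1 k).2).isCompact) hf
  obtain ⟨n, hn⟩ : ∃ n, cylinder f (fun k => (s.1 k : Set X)) n ⊆ U :=
    exists_subset_nhds_of_isCompact' antitone_cylinder.directed_ge hcompact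
      (fun n => (hcompact n).isClosed) (by simpa [hψ s] using hU)
  filter_upwards [(MarkovShift.isOpen_setOf_forall_le_eq s.1 n).mem_nhds fun _ _ => rfl] with t ht
  refine hn (mem_iInter₂.2 fun k hk => ?_)
  have := hψ.iterate_mem t k
  rwa [ht k hk] at this

lemma IsMarkovPartition.apply_mem_arcEnds (hP : IsMarkovPartition f P) {i j : Set X} (hi : i ∈ P)
    (hj : j ∈ P) (hij : j ⊆ f '' i) {x : X} (hx : x ∈ arcEnds i) (hxj : f x ∈ j) :
    f x ∈ arcEnds j :=
  (hP.tame.isArc hj).mem_arcEnds_of_subset hij (apply_mem_arcEnds_image (hP.monotone i hi) hx) hxj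

lemma IsCoding.iterate_mem_arcEnds (hψ : IsCoding f P ψ) (hP : IsMarkovPartition f P)
    {s : MarkovShift (transitionMatrix f P)} {n m : ℕ} (hn : f^[n] (ψ s) ∈ partitionPoints P)
    (hnm : n ≤ m) : f^[m] (ψ s) ∈ arcEnds (s.1 m : Set X) := by
  induction m, hnm using Nat.le_induction with
  | base => exact mem_arcEnds_of_mem_partitionPoints hn (s.1 n).2 (hψ.iterate_mem s n)
  | succ m _ ih =>
    have hmem := hψ.iterate_mem s (m + 1)
    rw [Function.iterate_succ_apply'] at hmem ⊢
    exact hP.apply_mem_arcEnds (s.1 m).2 (s.1 (m + 1)).2 (s.subset_image m) ih hmem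

lemma IsCoding.eq_of_forall_le_eq (hψ : IsCoding f P ψ) (hP : IsMarkovPartition f P)
    {s t : MarkovShift (transitionMatrix f P)} (hst : ψ s = ψ t) {n : ℕ}
    (hn : f^[n] (ψ s) ∈ partitionPoints P) (hle : ∀ k ≤ n, s.1 k = t.1 k) : s = t := by
  refine Subtype.ext (funext fun m => ?_)
  rcases le_total m n with hm | hm
  · exact hle m hm
  induction m, hm using Nat.le_induction with
  | base => exact hle n le_rfl
  | succ m hm ih =>
    have hend := apply_mem_arcEnds_image (hP.monotone _ (s.1 m).2) (hψ.iterate_mem_arcEnds hP hn hm)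
    rw [← Function.iterate_succ_apply' f] at hend
    exact Subtype.ext (hP.tame.eq_of_mem_arcEnds (s.1 (m + 1)).2 (t.1 (m + 1)).2 hend
      (s.subset_image m) (ih ▸ t.subset_image m) (hψ.iterate_mem s _)
      (hst ▸ hψ.iterate_mem t _))

lemma IsCoding.countable_preimage_singleton (hψ : IsCoding f P ψ) (hP : IsMarkovPartition f P)
    {x : X} (hx : x ∈ exceptionalSet f P) : (ψ ⁻¹' {x}).Countable := by
  obtain ⟨n, hn⟩ := mem_iUnion.1 hx
  have : Countable P := hP.tame.countable.to_subtype
  refine MapsTo.countable_of_injOn (f := fun s (k : Iic n) => s.1 k) (mapsTo_univ _ _) ?_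
    countable_univ
  rintro s rfl t (ht : ψ t = ψ s) hst
  exact hψ.eq_of_forall_le_eq hP ht.symm hn fun k hk => congrFun hst ⟨k, hk⟩

theorem IsCoding.countable_preimage_exceptionalSet (hψ : IsCoding f P ψ)
    (hP : IsMarkovPartition f P) : (ψ ⁻¹' exceptionalSet f P).Countable := by
  rw [← biUnion_preimage_singleton]
  exact hP.countable_exceptionalSet.biUnion fun _ => hψ.countable_preimage_singleton hP

lemma IsMarkovPartition.exists_forall_iterate_mem_arcInterior (hP : IsMarkovPartition f P) {x : X}
    (hx : x ∉ exceptionalSet f P) :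
    ∃ s : MarkovShift (transitionMatrix f P), ∀ n, f^[n] x ∈ arcInterior (s.1 n : Set X) := by
  choose i hi using notMem_exceptionalSet_iff.1 hx
  refine ⟨⟨i, fun n => transitionMatrix_eq_one_iff.2 ?_⟩, hi⟩
  refine hP.markov _ (i n).2 _ (i (n + 1)).2 ⟨f^[n + 1] x, ?_, hi (n + 1)⟩
  rw [Function.iterate_succ_apply']
  exact mem_image_of_mem f (hi n).1

theorem IsCoding.exists_homeomorph [T2Space X] (hψ : IsCoding f P ψ) (hP : IsMarkovPartition f P)
    (hf : Continuous f) :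
    ∃ e : ↥((ψ ⁻¹' exceptionalSet f P)ᶜ) ≃ₜ ↥((exceptionalSet f P)ᶜ), ∀ s, (e s : X) = ψ s := by
  choose g hg using fun x : ↥((exceptionalSet f P)ᶜ) =>
    hP.exists_forall_iterate_mem_arcInterior x.2
  have hψg (x) : ψ (g x) = x := hψ.eq_of_forall_iterate_mem fun n => (hg x n).1
  have eq_g (x : ↥((exceptionalSet f P)ᶜ)) (n) (j : P) (h : f^[n] (x : X) ∈ (j : Set X)) :
      (g x).1 n = j :=
    (Subtype.ext (hP.tame.eq_of_mem_arcInterior j.2 ((g x).1 n).2 h (hg x n))).symm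
  have hgψ (s) (hs : ψ s ∉ exceptionalSet f P) : g ⟨ψ s, hs⟩ = s :=
    Subtype.ext (funext fun n => eq_g ⟨ψ s, hs⟩ n (s.1 n) (hψ.iterate_mem s n))
  have hgc : Continuous g := by
    refine MarkovShift.continuous_of_isOpen fun n a => ?_
    have hfibre : {x : ↥((exceptionalSet f P)ᶜ) | (g x).1 n = a} =
        (fun x : ↥((exceptionalSet f P)ᶜ) => f^[n] (x : X)) ⁻¹' arcInterior (a : Set X) :=
      Subset.antisymm (fun x h => h ▸ hg x n) fun x h => eq_g x n a h.1
    exact hfibre ▸ (hP.tame.isOpen_arcInterior a.2).preimage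
      ((hf.iterate n).comp continuous_subtype_val)
  exact ⟨{
    toFun := fun s => ⟨ψ s, s.2⟩
    invFun := fun x => ⟨g x, fun h => x.2 (hψg x ▸ h)⟩
    left_inv := fun s => Subtype.ext (hgψ s s.2)
    right_inv := fun x => Subtype.ext (hψg x)
    continuous_toFun := ((hψ.continuous hP.tame hf).comp continuous_subtype_val).subtype_mk _
    continuous_invFun := hgc.subtype_mk _ }, fun _ => rfl⟩

variable [MeasurableSpace X] [BorelSpace X]

lemma IsMarkovPartition.isSmall_exceptionalSet [T1Space X] (hP : IsMarkovPartition f P) :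
    IsSmall f (exceptionalSet f P) :=
  isSmall_of_countable hP.countable_exceptionalSet.measurableSet hP.countable_exceptionalSet
    preimage_exceptionalSet_subset

lemma IsCoding.isSmall_preimage_exceptionalSet [T2Space X] (hψ : IsCoding f P ψ)
    (hP : IsMarkovPartition f P) (hf : Continuous f) :
    IsSmall (MarkovShift.shift (transitionMatrix f P)) (ψ ⁻¹' exceptionalSet f P) := by
  refine isSmall_of_countable
    ((hψ.continuous hP.tame hf).measurable hP.countable_exceptionalSet.measurableSet)
    (hψ.countable_preimage_exceptionalSet hP) fun s hs => ?_
  rw [mem_preimage, mem_preimage, hψ.apply_shift] at hs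
  exact preimage_exceptionalSet_subset hs

end Coding

theorem mainTheorem7_general {G : Type u} [TopologicalSpace G] [T2Space G] [MeasurableSpace G]
    [BorelSpace G] {f : G → G} (hf : Continuous f) (hmix : IsTopMixing f) {P : Set (Set G)}
    (hP : IsMarkovPartition f P) :
    IsomorphicModSmallSets f (MarkovShift.shift (transitionMatrix f P)) ∧
      ∃ ψ : MarkovShift (transitionMatrix f P) → G,
        (∀ s, ⋂ n, cylinder f (fun k => (s.1 k : Set G)) n = {ψ s}) ∧
        (exceptionalSet f P).Countable ∧ (ψ ⁻¹' exceptionalSet f P).Countable ∧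
        ∃ e : ↥((ψ ⁻¹' exceptionalSet f P)ᶜ) ≃ᵐ ↥((exceptionalSet f P)ᶜ),
          IsIsoModSmall (MarkovShift.shift (transitionMatrix f P)) f
              (ψ ⁻¹' exceptionalSet f P) (exceptionalSet f P) e ∧
            ∀ s, (e s : G) = ψ s := by
  obtain ⟨ψ, hψ⟩ := hP.exists_isCoding hf hmix
  obtain ⟨e, he⟩ := hψ.exists_homeomorph hP hf
  have iso : IsIsoModSmall (MarkovShift.shift (transitionMatrix f P)) f
      (ψ ⁻¹' exceptionalSet f P) (exceptionalSet f P) e.toMeasurableEquiv :=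
    { small_source := hψ.isSmall_preimage_exceptionalSet hP hf
      small_target := hP.isSmall_exceptionalSet
      intertwine := fun s t hst => by
        change f (e s) = e t
        rw [he, he, hst, hψ.apply_shift] }
  exact ⟨⟨_, _, _, iso.symm⟩, ψ, hψ, hP.countable_exceptionalSet,
    hψ.countable_preimage_exceptionalSet hP, e.toMeasurableEquiv, iso, he⟩

end TameGraph

theorem mainTheorem7 {G : Type u} [TopologicalSpace G] [MeasurableSpace G] [BorelSpace G]
    (hG : TameGraph.IsTameGraph G) (f : G → G) (hf : TameGraph.IsCPM f)
    (P : Set (Set G)) (hP : TameGraph.IsMarkovPartition f P) :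
    TameGraph.IsomorphicModSmallSets f
        (TameGraph.MarkovShift.shift (TameGraph.transitionMatrix f P)) ∧
      ∃ ψ : TameGraph.MarkovShift (TameGraph.transitionMatrix f P) → G,
        (∀ s, ⋂ n, TameGraph.cylinder f (fun k => (s.1 k : Set G)) n = {ψ s}) ∧
        (TameGraph.exceptionalSet f P).Countable ∧
        (ψ ⁻¹' TameGraph.exceptionalSet f P).Countable ∧
        ∃ e : ↥((ψ ⁻¹' TameGraph.exceptionalSet f P)ᶜ) ≃ᵐ
            ↥((TameGraph.exceptionalSet f P)ᶜ),
          TameGraph.IsIsoModSmall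
              (TameGraph.MarkovShift.shift (TameGraph.transitionMatrix f P)) f
              (ψ ⁻¹' TameGraph.exceptionalSet f P) (TameGraph.exceptionalSet f P) e ∧
            ∀ s, (e s : G) = ψ s := by
  have := hG.metrizable
  exact TameGraph.mainTheorem7_general hf.continuous hf.mixing hP
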